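/- Let $X,Y$ be finite sets and let $f$ be a (partial or total) Boolean function on $X\times Y$; put $f^t(y,x):=f(x,y)$. Let $Q^1(f)$ be the unbounded-error one-way quantum communication complexity of $f$: the least $n$ for which there are $n$-qubit mixed states $\rho_x$ ($x\in X$), sent by Alice, and two-outcome POVMs $\{E^0_y,E^1_y\}$ ($y\in Y$), performed by Bob, with $\mathrm{Tr}(E_y^{f(x,y)}\rho_x)>1/2$ for all $(x,y)$ in the domain of $f$. Let $Q^{\parallel}(f)$ be the unbounded-error quantum simultaneous-message-passing complexity: the least $m+n$ for which there are $m$-qubit mixed states $\rho_x$ sent by Alice and $n$-qubit mixed states $\sigma_y$ sent by Bob (without shared randomness or entanglement) and one two-outcome POVM $\{E^0,E^1\}$ of the referee, not depending on $x,y$, with $\mathrm{Tr}(E^{f(x,y)}(\rho_x\otimes\sigma_y))>1/2$ for all $(x,y)$ in the domain of $f$. Let $k_f$ be the least $k\ge 0$ for which there are points $p^x\in\mathbb R^k$ ($x\in X$) and hyperplanes given by $(h^y_1,\dots,h^y_{k+1})\in\mathbb R^{k+1}$ ($y\in Y$) such that $\sum_{i=1}^k p^x_ih^y_i-h^y_{k+1}$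 is positive if $f(x,y)=1$ and negative if $f(x,y)=0$, for all $(x,y)$ in the domain of $f$, and let $k_f^*=\min(k_f,k_{f^t})$. Then $$Q^1(f)+Q^1(f^t)\le Q^{\parallel}(f)\le Q^1(f)+Q^1(f^t)+2,$$ and in particular $$\lceil\log_2\sqrt{k_f+1}\,\rceil+\lceil\log_2\sqrt{k_{f^t}+1}\,\rceil\le Q^{\parallel}(f)\le 2\lceil\log_2\sqrt{k_f^*+2}\,\rceil.$$ -/

import Mathlib

open scoped Kronecker ComplexOrder

/-- A partial Boolean function on `X × Y`: `f x y = some b` means that `(x, y)` is in the domain and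
has value `b`, while `f x y = none` means that `(x, y)` is outside the domain. A total function is
one that never takes the value `none`. -/
abbrev BoolFun (X Y : Type*) : Type _ := X → Y → Option Bool

/-- The transposed function `fᵗ (y, x) = f (x, y)`. -/
def BoolFun.transpose {X Y : Type*} (f : BoolFun X Y) : BoolFun Y X := fun y x => f x y

/-! ### Arrangements of points and hyperplanes -/

/-- An arrangement in `ℝᵏ`: a point for every `x`, and for every `y` a hyperplane
`{a | ∑ i, a i * h i = t}`, recorded by its coefficient vector `h` and its right-hand side `t`. -/
structure Arrangement (X Y : Type*) (k : ℕ) where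
  point : X → Fin k → ℝ
  normal : Y → Fin k → ℝ
  offset : Y → ℝ

/-- The signed quantity `∑ i, pᵢ hᵢ - h_{k+1}` for the point of `x` and the hyperplane of `y`. -/
def Arrangement.value {X Y : Type*} {k : ℕ} (A : Arrangement X Y k) (x : X) (y : Y) : ℝ :=
  ∑ i, A.point x i * A.normal y i - A.offset y

/-- The arrangement realizes `f`: on the domain of `f` the sign is positive where `f` is true and
negative where `f` is false (in particular it is never zero there). -/
def Arrangement.Realizes {X Y : Type*} {k : ℕ} (A : Arrangement X Y k) (f : BoolFun X Y) : Prop :=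
  ∀ x y, (f x y = some true → 0 < A.value x y) ∧ (f x y = some false → A.value x y < 0)

/-- `k_f`: the minimum dimension of an arrangement realizing `f`. (For finite `X` the set is
nonempty: take linearly independent points.) -/
noncomputable def minDim {X Y : Type*} (f : BoolFun X Y) : ℕ :=
  sInf {k : ℕ | ∃ A : Arrangement X Y k, A.Realizes f}

/-! ### Quantum states and measurements -/

/-- Mixed states (density matrices) of a quantum system with computational basis `ι`. -/
structure MixedState (ι : Type*) [Fintype ι] where
  mat : Matrix ι ι ℂ
  posSemidef : mat.PosSemidef
  trace_eq_one : mat.trace = 1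

/-- Two-outcome POVMs on a quantum system with computational basis `ι`. -/
structure BinaryPOVM (ι : Type*) [Fintype ι] [DecidableEq ι] where
  elem : Bool → Matrix ι ι ℂ
  posSemidef : ∀ b, (elem b).PosSemidef
  sum_eq_one : ∑ b, elem b = 1

/-- Born rule: the probability of outcome `b` when `M` is measured on a system whose density matrix
is `ρ`, namely the trace of `M_b ρ` (a real number when `ρ` is positive semidefinite). -/
noncomputable def BinaryPOVM.prob {ι : Type*} [Fintype ι] [DecidableEq ι]
    (M : BinaryPOVM ι) (ρ : Matrix ι ι ℂ) (b : Bool) : ℝ :=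
  (M.elem b * ρ).trace.re

/-! ### One-way protocols -/

/-- A one-way quantum protocol with `n` qubits of communication: on input `x` Alice sends an
`n`-qubit state to Bob, who measures it with a POVM depending on his input `y` and outputs the
outcome. -/
structure OneWayProtocol (X Y : Type*) (n : ℕ) where
  state : X → MixedState (Fin (2 ^ n))
  meas : Y → BinaryPOVM (Fin (2 ^ n))

/-- The protocol computes `f` with unbounded error: on every input in the domain of `f` the correct
value is output with probability greater than `1/2`. -/
def OneWayProtocol.Computes {X Y : Type*} {n : ℕ} (P : OneWayProtocol X Y n)
    (f : BoolFun X Y) : Prop :=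
  ∀ x y b, f x y = some b → 1 / 2 < (P.meas y).prob (P.state x).mat b

/-- `Q¹(f)`: the unbounded-error one-way quantum communication complexity of `f`. -/
noncomputable def oneWayQCC {X Y : Type*} (f : BoolFun X Y) : ℕ :=
  sInf {n : ℕ | ∃ P : OneWayProtocol X Y n, P.Computes f}

/-! ### Simultaneous message passing protocols -/

/-- A quantum SMP protocol in which Alice sends `m` qubits and Bob sends `n` qubits to a referee, who
has no input and performs one fixed joint measurement on the two messages. -/
structure SMPProtocol (X Y : Type*) (m n : ℕ) where
  alice : X → MixedState (Fin (2 ^ m))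
  bob : Y → MixedState (Fin (2 ^ n))
  referee : BinaryPOVM (Fin (2 ^ m) × Fin (2 ^ n))

/-- The protocol computes `f` with unbounded error. There is no shared randomness or entanglement:
the referee receives the product state of the two messages. -/
def SMPProtocol.Computes {X Y : Type*} {m n : ℕ} (P : SMPProtocol X Y m n)
    (f : BoolFun X Y) : Prop :=
  ∀ x y b, f x y = some b → 1 / 2 < P.referee.prob ((P.alice x).mat ⊗ₖ (P.bob y).mat) b

/-- `Q^∥(f)`: the unbounded-error quantum SMP complexity, i.e. the minimum total number of qubits
sent to the referee. -/
noncomputable def smpQCC {X Y : Type*} (f : BoolFun X Y) : ℕ :=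
  sInf {c : ℕ | ∃ m n : ℕ, m + n = c ∧ ∃ P : SMPProtocol X Y m n, P.Computes f}

/-! ### Hermitian matrices as a real Euclidean space -/

/-! Everything is compared with `minDim f`, written k. Under the trace form the Hermitian matrices
of size 2^n are a Euclidean space of dimension 4^n. States have trace 1, so acceptance probabilities
are affine in 4^n - 1 coordinates, and an n-qubit one-way protocol gives k + 1 ≤ 4^n
(`minDim_add_one_le_of_computes`). Conversely, an arrangement is a sign representation by inner
products in dimension k + 1. If k + 2 ≤ 4^n, both vectors can be encoded in n-qubit states along
traceless directions, and one fixed measurement has bias a positive multiple of their inner product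
(`SignRepresents.exists_smpProtocol`). This costs 2n qubits. The lower bound on SMP lets either
party play the referee, preparing its own message locally (`SMPProtocol.toOneWay`,
`SMPProtocol.swap`). -/

theorem Matrix.IsHermitian.im_trace_mul {ι : Type*} [Fintype ι] {A B : Matrix ι ι ℂ}
    (hA : A.IsHermitian) (hB : B.IsHermitian) : (A * B).trace.im = 0 := by
  have h : star (A * B).trace = (A * B).trace := by
    rw [← Matrix.trace_conjTranspose, Matrix.conjTranspose_mul, hA.eq, hB.eq, Matrix.trace_mul_comm]
  exact Complex.conj_eq_iff_im.mp h

/-- The coordinates of a Hermitian matrix `S + iK` (`S` symmetric, `K` antisymmetric, both real) in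
the space of real matrices, namely `S + K`. -/
noncomputable def hermitianCoords {ι : Type*} (A : Matrix ι ι ℂ) : EuclideanSpace ℝ (ι × ι) :=
  WithLp.toLp 2 fun p => (A p.1 p.2).re + (A p.1 p.2).im

/-- The Hermitian matrix with given coordinates. -/
noncomputable def hermitianOfCoords {ι : Type*} (v : EuclideanSpace ℝ (ι × ι)) : Matrix ι ι ℂ :=
  Matrix.of fun i j => ⟨(v (i, j) + v (j, i)) / 2, (v (i, j) - v (j, i)) / 2⟩

theorem isHermitian_hermitianOfCoords {ι : Type*} (v : EuclideanSpace ℝ (ι × ι)) :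
    (hermitianOfCoords v).IsHermitian := by
  ext i j
  apply Complex.ext <;> simp [hermitianOfCoords] <;> ring

theorem hermitianCoords_hermitianOfCoords {ι : Type*} (v : EuclideanSpace ℝ (ι × ι)) :
    hermitianCoords (hermitianOfCoords v) = v := by
  ext ⟨i, j⟩
  simp only [hermitianCoords, hermitianOfCoords, Matrix.of_apply]
  ring

/-- The cross terms vanish, because symmetric and antisymmetric real matrices are orthogonal. -/
theorem inner_hermitianCoords {ι : Type*} [Fintype ι] {A B : Matrix ι ι ℂ}
    (hA : A.IsHermitian) (hB : B.IsHermitian) :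
    inner ℝ (hermitianCoords A) (hermitianCoords B) = (A * B).trace.re := by
  have key : ∀ C D : Matrix ι ι ℂ, C.IsHermitian → D.IsHermitian →
      ∑ i, ∑ j, (C i j).re * (D i j).im = 0 := by
    intro C D hC hD
    have h : ∑ i, ∑ j, (C i j).re * (D i j).im = -∑ i, ∑ j, (C i j).re * (D i j).im := by
      conv_lhs => rw [Finset.sum_comm]
      simp only [← Finset.sum_neg_distrib]
      refine Finset.sum_congr rfl fun i _ => Finset.sum_congr rfl fun j _ => ?_
      rw [← hC.apply j i, ← hD.apply j i]
      simp
    linarith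
  have h1 := key A B hA hB
  have h2 := key B A hB hA
  have h3 : (A * B).trace.re =
      ∑ i, ∑ j, ((A i j).re * (B i j).re + (A i j).im * (B i j).im) := by
    simp only [Matrix.trace, Matrix.diag_apply, Matrix.mul_apply, Complex.re_sum]
    refine Finset.sum_congr rfl fun i _ => Finset.sum_congr rfl fun j _ => ?_
    rw [← hB.apply j i]
    simp
  rw [h3, PiLp.inner_apply, Fintype.sum_prod_type]
  have h4 : ∑ i, ∑ j, inner ℝ ((hermitianCoords A) (i, j)) ((hermitianCoords B) (i, j)) =
      ∑ i, ∑ j, ((A i j).re * (B i j).re + (A i j).im * (B i j).im)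
      + ∑ i, ∑ j, (A i j).re * (B i j).im + ∑ i, ∑ j, (B i j).re * (A i j).im := by
    simp only [← Finset.sum_add_distrib]
    refine Finset.sum_congr rfl fun i _ => Finset.sum_congr rfl fun j _ => ?_
    simp [hermitianCoords]
    ring
  rw [h4, h1, h2]
  ring

/-- An orthonormal family of traceless Hermitian matrices which, together with a multiple of the
identity, spans all Hermitian matrices. -/
theorem exists_traceless_orthonormal (N d : ℕ) (hd : d + 1 = N * N) :
    ∃ H : Fin d → Matrix (Fin N) (Fin N) ℂ, (∀ i, (H i).IsHermitian) ∧ (∀ i, (H i).trace = 0) ∧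
      (∀ i j, (H i * H j).trace = if i = j then 1 else 0) ∧
      ∀ A B : Matrix (Fin N) (Fin N) ℂ, A.IsHermitian → B.IsHermitian →
        (A * B).trace.re =
          ∑ i, (A * H i).trace.re * (B * H i).trace.re + A.trace.re * B.trace.re / N := by
  have hN : 0 < N := Nat.pos_of_ne_zero (by rintro rfl; omega)
  have hN' : (0 : ℝ) < N := by exact_mod_cast hN
  have h1 : (1 : Matrix (Fin N) (Fin N) ℂ).IsHermitian := Matrix.isHermitian_one
  set u := hermitianCoords (1 : Matrix (Fin N) (Fin N) ℂ) with hu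
  have huu : ‖u‖ ^ 2 = N := by
    rw [← real_inner_self_eq_norm_sq, inner_hermitianCoords h1 h1]
    simp
  have hu0 : ‖u‖ ≠ 0 := by
    intro h
    rw [h] at huu
    linarith
  -- Only index 0 matters: the normalized identity is extended to an orthonormal basis, whose other
  -- members are then traceless.
  let w : Fin (d + 1) → EuclideanSpace ℝ (Fin N × Fin N) := fun _ => ‖u‖⁻¹ • u
  have hw : Orthonormal ℝ (({0} : Set (Fin (d + 1))).domRestrict w) := by
    refine ⟨fun i => ?_, fun i j hij => (hij (Subsingleton.elim _ _)).elim⟩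
    change ‖‖u‖⁻¹ • u‖ = 1
    simp [norm_smul, hu0]
  obtain ⟨b, hb⟩ := hw.exists_orthonormalBasis_extension_of_card_eq (by simp [hd])
  have hb0 : b 0 = ‖u‖⁻¹ • u := hb 0 rfl
  have hcoords : ∀ i, hermitianCoords (hermitianOfCoords (b i)) = b i := fun i =>
    hermitianCoords_hermitianOfCoords _
  have hinner : ∀ A : Matrix (Fin N) (Fin N) ℂ, A.IsHermitian → ∀ i : Fin (d + 1),
      inner ℝ (hermitianCoords A) (b i) = (A * hermitianOfCoords (b i)).trace.re := by
    intro A hA i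
    rw [← inner_hermitianCoords hA (isHermitian_hermitianOfCoords _), hcoords]
  have htr : ∀ A : Matrix (Fin N) (Fin N) ℂ, A.IsHermitian →
      inner ℝ (hermitianCoords A) u = A.trace.re := by
    intro A hA
    rw [hu, inner_hermitianCoords hA h1, mul_one]
  refine ⟨fun i => hermitianOfCoords (b i.succ), fun i => isHermitian_hermitianOfCoords _,
    fun i => ?_, fun i j => ?_, fun A B hA hB => ?_⟩
  · apply Complex.ext
    · have h := b.orthonormal.2 (Fin.succ_ne_zero i)
      change inner ℝ (b i.succ) (b 0) = 0 at h
      rw [hb0, inner_smul_right, ← hcoords, htr _ (isHermitian_hermitianOfCoords _)] at h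
      simpa [hu0] using h
    · simpa using (isHermitian_hermitianOfCoords (b i.succ)).im_trace_mul h1
  · apply Complex.ext
    · rw [← hinner _ (isHermitian_hermitianOfCoords _), hcoords,
        orthonormal_iff_ite.mp b.orthonormal]
      simp only [Fin.succ_inj]
      split_ifs <;> simp
    · rw [(isHermitian_hermitianOfCoords (b i.succ)).im_trace_mul
        (isHermitian_hermitianOfCoords (b j.succ))]
      split_ifs <;> simp
  · rw [← inner_hermitianCoords hA hB, ← b.sum_inner_mul_inner, Fin.sum_univ_succ, add_comm]
    congr 1
    · refine Finset.sum_congr rfl fun i _ => ?_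
      rw [hinner A hA, real_inner_comm, hinner B hB]
    · rw [hb0, inner_smul_right, inner_smul_left, htr A hA, real_inner_comm, htr B hB, ← huu]
      simp
      field_simp

open scoped Matrix.Norms.L2Operator MatrixOrder in
-- Since ±A ≤ ‖A‖, the choice ε = 1 / (‖A‖ + 1) works, also for A = 0.
theorem Matrix.IsHermitian.exists_pos_posSemidef_add_smul {ι : Type*} [Fintype ι] [DecidableEq ι]
    {A : Matrix ι ι ℂ} (hA : A.IsHermitian) :
    ∃ ε : ℝ, 0 < ε ∧ (1 + (ε : ℂ) • A).PosSemidef ∧ (1 - (ε : ℂ) • A).PosSemidef := by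
  have hpos : 0 < ‖A‖ + 1 := by positivity
  have key : ∀ B : Matrix ι ι ℂ, B.IsHermitian → ‖B‖ = ‖A‖ →
      (1 - (((‖A‖ + 1)⁻¹ : ℝ) : ℂ) • B).PosSemidef := by
    intro B hB hBA
    have h := IsSelfAdjoint.le_algebraMap_norm_self (a := B) hB
    rw [Matrix.le_iff, hBA] at h
    have h2 := (h.add Matrix.PosSemidef.one).smul
      (a := (((‖A‖ + 1)⁻¹ : ℝ) : ℂ)) (by exact_mod_cast (inv_pos.mpr hpos).le)
    have h3 : algebraMap ℝ (Matrix ι ι ℂ) ‖A‖ = ((‖A‖ : ℝ) : ℂ) • 1 := by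
      rw [Algebra.algebraMap_eq_smul_one]; rfl
    have h4 : (((‖A‖ + 1)⁻¹ : ℝ) : ℂ) * (((‖A‖ : ℝ) : ℂ) + 1) = 1 := by
      exact_mod_cast inv_mul_cancel₀ hpos.ne'
    have h5 : (((‖A‖ + 1)⁻¹ : ℝ) : ℂ) • (algebraMap ℝ (Matrix ι ι ℂ) ‖A‖ - B + 1) =
        1 - (((‖A‖ + 1)⁻¹ : ℝ) : ℂ) • B := by
      rw [h3, sub_add_eq_add_sub, smul_sub, smul_add, smul_smul, ← add_smul, ← mul_add_one, h4,
        one_smul]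
    exact h5 ▸ h2
  refine ⟨(‖A‖ + 1)⁻¹, inv_pos.mpr hpos, ?_, key A hA rfl⟩
  have := key (-A) hA.neg (norm_neg A)
  simpa [sub_neg_eq_add] using this

/-! ### From one-way protocols to arrangements -/

theorem BinaryPOVM.prob_true_add_prob_false {ι : Type*} [Fintype ι] [DecidableEq ι]
    (M : BinaryPOVM ι) (ρ : MixedState ι) : M.prob ρ.mat true + M.prob ρ.mat false = 1 := by
  have h := M.sum_eq_one
  rw [Fintype.sum_bool] at h
  rw [BinaryPOVM.prob, BinaryPOVM.prob, ← Complex.add_re, ← Matrix.trace_add, ← add_mul, h, one_mul,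
    ρ.trace_eq_one, Complex.one_re]

theorem OneWayProtocol.exists_realizes {X Y : Type*} {n k : ℕ} (P : OneWayProtocol X Y n)
    {f : BoolFun X Y} (hP : P.Computes f) (hk : k + 1 = 2 ^ n * 2 ^ n) :
    ∃ A : Arrangement X Y k, A.Realizes f := by
  obtain ⟨H, -, -, -, hH⟩ := exists_traceless_orthonormal (2 ^ n) k hk
  let A : Arrangement X Y k :=
    { point := fun x i => ((P.state x).mat * H i).trace.re
      normal := fun y i => ((P.meas y).elem true * H i).trace.re
      -- The identity component contributes the constant Tr E / 2^n, as the state has trace 1.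
      offset := fun y => 1 / 2 - ((P.meas y).elem true).trace.re / (2 ^ n : ℕ) }
  have hA : ∀ x y, A.value x y = (P.meas y).prob (P.state x).mat true - 1 / 2 := by
    intro x y
    rw [BinaryPOVM.prob, hH _ _ ((P.meas y).posSemidef true).isHermitian
      (P.state x).posSemidef.isHermitian, (P.state x).trace_eq_one, Arrangement.value]
    simp only [A, Complex.one_re, mul_comm]
    ring
  refine ⟨A, fun x y => ⟨fun h => ?_, fun h => ?_⟩⟩
  · rw [hA]
    linarith [hP x y true h]
  · rw [hA]
    linarith [hP x y false h, (P.meas y).prob_true_add_prob_false (P.state x)]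

theorem minDim_add_one_le_of_computes {X Y : Type*} {n : ℕ} (P : OneWayProtocol X Y n)
    {f : BoolFun X Y} (hP : P.Computes f) : minDim f + 1 ≤ 4 ^ n := by
  have h4 : 4 ^ n = 2 ^ n * 2 ^ n := by rw [← mul_pow]; norm_num
  have hpos : 0 < 4 ^ n := by positivity
  have h : minDim f ≤ 4 ^ n - 1 := Nat.sInf_le (s := {k : ℕ | ∃ A : Arrangement X Y k, A.Realizes f})
    (P.exists_realizes hP (by omega))
  omega

/-! ### From simultaneous messages to one-way communication -/

/-- The effect on the first of two systems obtained from a joint effect `E` when the second system is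
prepared in the state `σ`. -/
def conditionalEffect {ι κ : Type*} [Fintype κ] (E : Matrix (ι × κ) (ι × κ) ℂ)
    (σ : Matrix κ κ ℂ) : Matrix ι ι ℂ :=
  Matrix.of fun i i' => ∑ j, ∑ j', E (i, j) (i', j') * σ j' j

theorem trace_conditionalEffect_mul {ι κ : Type*} [Fintype ι] [Fintype κ]
    (E : Matrix (ι × κ) (ι × κ) ℂ) (σ : Matrix κ κ ℂ) (ρ : Matrix ι ι ℂ) :
    (conditionalEffect E σ * ρ).trace = (E * (ρ ⊗ₖ σ)).trace := by
  simp only [Matrix.trace, Matrix.diag_apply, Matrix.mul_apply, conditionalEffect, Matrix.of_apply,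
    Fintype.sum_prod_type, Matrix.kroneckerMap_apply, Finset.sum_mul]
  refine Finset.sum_congr rfl fun i _ => ?_
  rw [Finset.sum_comm]
  refine Finset.sum_congr rfl fun j _ => Finset.sum_congr rfl fun i' _ =>
    Finset.sum_congr rfl fun j' _ => ?_
  ring

theorem conditionalEffect_add {ι κ : Type*} [Fintype κ] (E F : Matrix (ι × κ) (ι × κ) ℂ)
    (σ : Matrix κ κ ℂ) :
    conditionalEffect (E + F) σ = conditionalEffect E σ + conditionalEffect F σ := by
  ext i i'
  simp [conditionalEffect, add_mul, Finset.sum_add_distrib]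

theorem conditionalEffect_one {ι κ : Type*} [DecidableEq ι] [Fintype κ] [DecidableEq κ]
    {σ : Matrix κ κ ℂ} (hσ : σ.trace = 1) :
    conditionalEffect (1 : Matrix (ι × κ) (ι × κ) ℂ) σ = 1 := by
  ext i i'
  rw [Matrix.trace] at hσ
  by_cases h : i = i'
  · subst h
    simpa [conditionalEffect, Matrix.one_apply] using hσ
  · simp [conditionalEffect, Matrix.one_apply, h]

open scoped MatrixOrder in
-- With σ = B*B, the effect is a sum of compressions V* E V, where V tensors with a conjugated row
-- of B.
theorem Matrix.PosSemidef.conditionalEffect {ι κ : Type*} [Fintype ι] [DecidableEq ι] [Fintype κ]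
    [DecidableEq κ] {E : Matrix (ι × κ) (ι × κ) ℂ} {σ : Matrix κ κ ℂ} (hE : E.PosSemidef)
    (hσ : σ.PosSemidef) : (conditionalEffect E σ).PosSemidef := by
  obtain ⟨B, rfl⟩ := CStarAlgebra.nonneg_iff_eq_star_mul_self.mp hσ.nonneg
  let V : κ → Matrix (ι × κ) ι ℂ := fun k =>
    Matrix.of fun p i => if p.1 = i then star (B k p.2) else 0
  have h : _root_.conditionalEffect E (star B * B) = ∑ k, (V k).conjTranspose * E * V k := by
    ext i i'
    simp only [_root_.conditionalEffect, V, Matrix.of_apply, Matrix.sum_apply, Matrix.mul_apply,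
      Matrix.conjTranspose_apply, Fintype.sum_prod_type, Matrix.star_eq_conjTranspose, apply_ite star,
      star_star, star_zero, ite_mul, mul_ite, zero_mul, mul_zero, Finset.sum_ite_irrel,
      Finset.sum_const_zero, Finset.sum_ite_eq', Finset.mem_univ, if_true,
      Finset.mul_sum, Finset.sum_mul]
    rw [Finset.sum_comm, Finset.sum_comm (γ := κ) (s := Finset.univ) (t := Finset.univ)
      (f := fun c x => ∑ x_1, B c x_1 * E (i, x_1) (i', x) * star (B c x))]
    refine Finset.sum_congr rfl fun j' _ => ?_
    rw [Finset.sum_comm (f := fun c j => B c j * E (i, j) (i', j') * star (B c j'))]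
    refine Finset.sum_congr rfl fun j _ => Finset.sum_congr rfl fun k _ => ?_
    ring
  rw [h]
  exact Matrix.posSemidef_sum _ fun k _ => hE.conjTranspose_mul_mul_same _

/-- The one-way protocol in which the receiver prepares the second message himself and applies the
referee's measurement. -/
def SMPProtocol.toOneWay {X Y : Type*} {m n : ℕ} (P : SMPProtocol X Y m n) :
    OneWayProtocol X Y m where
  state := P.alice
  meas := fun y =>
    { elem := fun b => conditionalEffect (P.referee.elem b) (P.bob y).mat
      posSemidef := fun b => (P.referee.posSemidef b).conditionalEffect (P.bob y).posSemidef
      sum_eq_one := by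
        have h := P.referee.sum_eq_one
        rw [Fintype.sum_bool] at h
        rw [Fintype.sum_bool, ← conditionalEffect_add, h,
          conditionalEffect_one (P.bob y).trace_eq_one] }

theorem SMPProtocol.toOneWay_computes {X Y : Type*} {m n : ℕ} {P : SMPProtocol X Y m n}
    {f : BoolFun X Y} (hP : P.Computes f) : P.toOneWay.Computes f := by
  intro x y b h
  have := hP x y b h
  rwa [BinaryPOVM.prob, ← trace_conditionalEffect_mul] at this

/-- Exchange the roles of Alice and Bob. -/
def SMPProtocol.swap {X Y : Type*} {m n : ℕ} (P : SMPProtocol X Y m n) : SMPProtocol Y X n m where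
  alice := P.bob
  bob := P.alice
  referee :=
    { elem := fun b => (P.referee.elem b).submatrix Prod.swap Prod.swap
      posSemidef := fun b => (P.referee.posSemidef b).submatrix _
      sum_eq_one := by
        have h := P.referee.sum_eq_one
        rw [Fintype.sum_bool] at h
        rw [Fintype.sum_bool]
        change (P.referee.elem true + P.referee.elem false).submatrix Prod.swap Prod.swap = 1
        rw [h]
        exact Matrix.submatrix_one_equiv (Equiv.prodComm _ _) }

theorem SMPProtocol.swap_computes {X Y : Type*} {m n : ℕ} {P : SMPProtocol X Y m n}
    {f : BoolFun X Y} (hP : P.Computes f) : P.swap.Computes f.transpose := by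
  intro y x b h
  have := hP x y b h
  convert this using 1
  simp only [BinaryPOVM.prob, SMPProtocol.swap, Matrix.trace, Matrix.diag_apply, Matrix.mul_apply,
    Matrix.submatrix_apply]
  rw [← (Equiv.prodComm _ _).sum_comp]
  congr 1
  refine Finset.sum_congr rfl fun p _ => ?_
  rw [← (Equiv.prodComm _ _).sum_comp]
  refine Finset.sum_congr rfl fun q _ => ?_
  simp [mul_comm]

/-! ### From arrangements to simultaneous messages -/

/-- `a` and `b` represent `f` by the signs of the inner products `⟨a x, b y⟩`. -/
def SignRepresents {X Y : Type*} {d : ℕ} (a : X → Fin d → ℝ) (b : Y → Fin d → ℝ)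
    (f : BoolFun X Y) : Prop :=
  ∀ x y, (f x y = some true → 0 < ∑ i, a x i * b y i) ∧
    (f x y = some false → ∑ i, a x i * b y i < 0)

/-- Perturb the maximally mixed state: (1 + ε ∑ vᵢ Hᵢ) / N is a state for small ε, and c = ε / N. -/
theorem exists_mixedState_trace_mul {N d : ℕ} (hN : 0 < N) {H : Fin d → Matrix (Fin N) (Fin N) ℂ}
    (hH : ∀ i, (H i).IsHermitian) (htr : ∀ i, (H i).trace = 0)
    (hon : ∀ i j, (H i * H j).trace = if i = j then 1 else 0) (v : Fin d → ℝ) :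
    ∃ (ρ : MixedState (Fin N)) (c : ℝ), 0 < c ∧ ∀ i, (H i * ρ.mat).trace = ((c * v i : ℝ) : ℂ) := by
  have hN' : (N : ℂ) ≠ 0 := by exact_mod_cast hN.ne'
  have hA : (∑ i, (v i : ℂ) • H i).IsHermitian := by
    refine isSelfAdjoint_sum _ fun i _ => ?_
    exact IsSelfAdjoint.smul (Complex.conj_ofReal _) (hH i)
  obtain ⟨ε, hε, hpos, -⟩ := hA.exists_pos_posSemidef_add_smul
  have hNinv : (0 : ℂ) ≤ ((N : ℝ)⁻¹ : ℝ) := by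
    exact_mod_cast (inv_nonneg.mpr (Nat.cast_nonneg N))
  refine ⟨⟨(((N : ℝ)⁻¹ : ℝ) : ℂ) • (1 + (ε : ℂ) • ∑ i, (v i : ℂ) • H i), hpos.smul hNinv, ?_⟩,
    (N : ℝ)⁻¹ * ε, by positivity, fun i => ?_⟩
  · simp [Matrix.trace_sum, htr, hN']
  · simp [mul_add, Finset.mul_sum, Matrix.trace_sum, htr, hon]
    ring

/-- The referee measures (1 ± εW) / 2 with W = ∑ Hᵢ ⊗ Hᵢ, whose expectation on a product state is ∑
Tr(Hᵢρ) Tr(Hᵢσ). -/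
theorem SignRepresents.exists_smpProtocol {X Y : Type*} {d n : ℕ} {a : X → Fin d → ℝ}
    {b : Y → Fin d → ℝ} {f : BoolFun X Y} (h : SignRepresents a b f) (hd : d + 1 ≤ 4 ^ n) :
    ∃ P : SMPProtocol X Y n n, P.Computes f := by
  have h4 : 4 ^ n = 2 ^ n * 2 ^ n := by rw [← mul_pow]; norm_num
  obtain ⟨G, hG, hGtr, hGon, -⟩ := exists_traceless_orthonormal (2 ^ n) (4 ^ n - 1) (by omega)
  let H : Fin d → Matrix (Fin (2 ^ n)) (Fin (2 ^ n)) ℂ := fun i => G (Fin.castLE (by omega) i)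
  have hH : ∀ i, (H i).IsHermitian := fun i => hG _
  have htr : ∀ i, (H i).trace = 0 := fun i => hGtr _
  have hon : ∀ i j, (H i * H j).trace = if i = j then 1 else 0 := by
    intro i j
    simp only [H, hGon, Fin.castLE_inj]
  have hN : 0 < 2 ^ n := by positivity
  choose ρ r hr hρ using fun x => exists_mixedState_trace_mul hN hH htr hon (a x)
  choose σ s hs hσ using fun y => exists_mixedState_trace_mul hN hH htr hon (b y)
  have hW : (∑ i, H i ⊗ₖ H i).IsHermitian := by
    refine isSelfAdjoint_sum _ fun i _ => ?_
    change (H i ⊗ₖ H i).conjTranspose = _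
    rw [Matrix.conjTranspose_kronecker, (hH i).eq]
  obtain ⟨ε, hε, hplus, hminus⟩ := hW.exists_pos_posSemidef_add_smul
  have hhalf : (0 : ℂ) ≤ ((1 / 2 : ℝ) : ℂ) := by
    exact_mod_cast (by norm_num : (0 : ℝ) ≤ 1 / 2)
  let P : SMPProtocol X Y n n :=
    { alice := ρ
      bob := σ
      referee :=
        { elem := fun o => ((1 / 2 : ℝ) : ℂ) •
            (bif o then 1 + (ε : ℂ) • ∑ i, H i ⊗ₖ H i else 1 - (ε : ℂ) • ∑ i, H i ⊗ₖ H i)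
          posSemidef := fun o => by
            cases o
            · exact hminus.smul hhalf
            · exact hplus.smul hhalf
          sum_eq_one := by
            rw [Fintype.sum_bool, ← smul_add]
            simp only [cond_true, cond_false, add_add_sub_cancel]
            rw [← two_smul ℂ, smul_smul]
            norm_num } }
  have htrace : ∀ x y, ((∑ i, H i ⊗ₖ H i) * ((ρ x).mat ⊗ₖ (σ y).mat)).trace =
      ((r x * s y * ∑ i, a x i * b y i : ℝ) : ℂ) := by
    intro x y
    simp only [Finset.sum_mul, Matrix.trace_sum, ← Matrix.mul_kronecker_mul, Matrix.trace_kronecker,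
      hρ, hσ, Finset.mul_sum, Complex.ofReal_sum]
    refine Finset.sum_congr rfl fun i _ => ?_
    push_cast
    ring
  have hone : ∀ x y, ((ρ x).mat ⊗ₖ (σ y).mat).trace = 1 := by
    intro x y
    rw [Matrix.trace_kronecker, (ρ x).trace_eq_one, (σ y).trace_eq_one, one_mul]
  have hprob : ∀ x y, P.referee.prob ((P.alice x).mat ⊗ₖ (P.bob y).mat) true =
        1 / 2 + 1 / 2 * (ε * (r x * s y * ∑ i, a x i * b y i)) ∧
      P.referee.prob ((P.alice x).mat ⊗ₖ (P.bob y).mat) false =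
        1 / 2 - 1 / 2 * (ε * (r x * s y * ∑ i, a x i * b y i)) := by
    intro x y
    constructor <;>
    · simp only [BinaryPOVM.prob, P, cond_true, cond_false, Matrix.smul_mul, Matrix.trace_smul,
        add_mul, sub_mul, one_mul, Matrix.trace_add, Matrix.trace_sub, hone, htrace, smul_eq_mul,
        Complex.re_ofReal_mul, Complex.add_re, Complex.sub_re, Complex.one_re, Complex.ofReal_re]
      ring
  refine ⟨P, fun x y o hf => ?_⟩
  have hpos : 0 < ε * (r x * s y) := mul_pos hε (mul_pos (hr x) (hs y))
  cases o
  · rw [(hprob x y).2]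
    have := mul_neg_of_pos_of_neg hpos ((h x y).2 hf)
    linarith
  · rw [(hprob x y).1]
    have := mul_pos hpos ((h x y).1 hf)
    linarith

theorem exists_arrangement {X Y : Type*} [Finite X] (f : BoolFun X Y) :
    {k : ℕ | ∃ A : Arrangement X Y k, A.Realizes f}.Nonempty := by
  obtain ⟨k, ⟨e⟩⟩ := Finite.exists_equiv_fin X
  let g : X → Y → ℝ := fun x y => (f x y).elim 0 fun b => bif b then 1 else -1
  refine ⟨k, ⟨fun x => Pi.single (e x) 1, fun y i => g (e.symm i) y, fun _ => 0⟩, fun x y => ?_⟩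
  have : ∑ i, (Pi.single (e x) 1 : Fin k → ℝ) i * g (e.symm i) y - 0 = g x y := by
    simp [Pi.single_apply]
  simp only [Arrangement.value, this, g]
  constructor <;> intro h <;> simp [h]

/-- Homogenization: the offset becomes one more coordinate. -/
theorem exists_signRepresents {X Y : Type*} [Finite X] (f : BoolFun X Y) :
    ∃ (a : X → Fin (minDim f + 1) → ℝ) (b : Y → Fin (minDim f + 1) → ℝ), SignRepresents a b f := by
  obtain ⟨A, hA⟩ : ∃ A : Arrangement X Y (minDim f), A.Realizes f :=
    Nat.sInf_mem (exists_arrangement f)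
  refine ⟨fun x => Fin.snoc (A.point x) 1, fun y => Fin.snoc (A.normal y) (-A.offset y),
    fun x y => ?_⟩
  have h := hA x y
  simpa [Fin.sum_univ_castSucc, Arrangement.value, sub_eq_add_neg] using h

theorem exists_smpProtocol {X Y : Type*} [Finite X] (f : BoolFun X Y) {n : ℕ}
    (hn : minDim f + 2 ≤ 4 ^ n) : ∃ P : SMPProtocol X Y n n, P.Computes f := by
  obtain ⟨a, b, h⟩ := exists_signRepresents f
  exact h.exists_smpProtocol hn

/-! ### Comparison of the complexity measures -/

theorem smpQCC_le {X Y : Type*} [Finite X] [Finite Y] (f : BoolFun X Y) {n : ℕ}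
    (hn : min (minDim f) (minDim f.transpose) + 2 ≤ 4 ^ n) : smpQCC f ≤ 2 * n := by
  have : ∃ P : SMPProtocol X Y n n, P.Computes f := by
    rcases le_total (minDim f) (minDim f.transpose) with h | h
    · rw [min_eq_left h] at hn
      exact exists_smpProtocol f hn
    · rw [min_eq_right h] at hn
      obtain ⟨P, hP⟩ := exists_smpProtocol f.transpose hn
      exact ⟨P.swap, P.swap_computes hP⟩
  exact Nat.sInf_le ⟨n, n, (two_mul n).symm, this⟩

theorem exists_smpProtocol_smpQCC {X Y : Type*} [Finite X] (f : BoolFun X Y) :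
    ∃ m n : ℕ, m + n = smpQCC f ∧ ∃ P : SMPProtocol X Y m n, P.Computes f := by
  have hne : {c : ℕ | ∃ m n : ℕ, m + n = c ∧ ∃ P : SMPProtocol X Y m n, P.Computes f}.Nonempty := by
    -- A crude qubit count suffices: nonemptiness ensures that the infimum is attained and is not
    -- the default 0.
    have h : minDim f + 2 ≤ 4 ^ (minDim f + 2) := (Nat.lt_pow_self (by norm_num)).le
    exact ⟨_, _, _, rfl, exists_smpProtocol f h⟩
  exact Nat.sInf_mem hne

theorem oneWayQCC_add_le_smpQCC {X Y : Type*} [Finite X] (f : BoolFun X Y) :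
    oneWayQCC f + oneWayQCC f.transpose ≤ smpQCC f := by
  obtain ⟨m, n, h, P, hP⟩ := exists_smpProtocol_smpQCC f
  rw [← h]
  exact add_le_add (Nat.sInf_le ⟨_, SMPProtocol.toOneWay_computes hP⟩)
    (Nat.sInf_le ⟨_, SMPProtocol.toOneWay_computes (SMPProtocol.swap_computes hP)⟩)

theorem minDim_add_one_le {X Y : Type*} [Finite X] (f : BoolFun X Y) :
    minDim f + 1 ≤ 4 ^ oneWayQCC f := by
  obtain ⟨m, n, -, P, hP⟩ := exists_smpProtocol_smpQCC f
  obtain ⟨Q, hQ⟩ : ∃ Q : OneWayProtocol X Y (oneWayQCC f), Q.Computes f :=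
    Nat.sInf_mem (s := {n : ℕ | ∃ P : OneWayProtocol X Y n, P.Computes f})
      ⟨_, _, SMPProtocol.toOneWay_computes hP⟩
  exact minDim_add_one_le_of_computes Q hQ

theorem logb_two_sqrt_le_iff {x : ℝ} (hx : 0 < x) (n : ℕ) : Real.logb 2 (√x) ≤ n ↔ x ≤ 4 ^ n := by
  rw [Real.logb_le_iff_le_rpow (by norm_num) (Real.sqrt_pos.mpr hx), Real.rpow_natCast,
    Real.sqrt_le_left (by positivity), ← pow_mul, mul_comm, pow_mul]
  norm_num

theorem ceil_logb_sqrt_minDim_le {X Y : Type*} [Finite X] (f : BoolFun X Y) :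
    ⌈Real.logb 2 (√((minDim f : ℝ) + 1))⌉ ≤ (oneWayQCC f : ℤ) := by
  rw [Int.ceil_le, Int.cast_natCast, logb_two_sqrt_le_iff (by positivity)]
  exact_mod_cast minDim_add_one_le f

theorem theorem2 {X Y : Type*} [Finite X] [Finite Y] (f : BoolFun X Y) :
    (oneWayQCC f + oneWayQCC f.transpose ≤ smpQCC f ∧
      smpQCC f ≤ oneWayQCC f + oneWayQCC f.transpose + 2) ∧
    (⌈Real.logb 2 (√((minDim f : ℝ) + 1))⌉ + ⌈Real.logb 2 (√((minDim f.transpose : ℝ) + 1))⌉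
        ≤ (smpQCC f : ℤ) ∧
      (smpQCC f : ℤ) ≤
        2 * ⌈Real.logb 2 (√((min (minDim f) (minDim f.transpose) : ℕ) + 2 : ℝ))⌉) := by
  have hlow := oneWayQCC_add_le_smpQCC f
  refine ⟨⟨hlow, ?_⟩, ?_, ?_⟩
  · have h1 := minDim_add_one_le f
    have h2 := minDim_add_one_le f.transpose
    rcases le_total (oneWayQCC f) (oneWayQCC f.transpose) with h | h
    · have := smpQCC_le f (n := oneWayQCC f + 1) (by rw [pow_succ]; omega)
      omega
    · have := smpQCC_le f (n := oneWayQCC f.transpose + 1) (by rw [pow_succ]; omega)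
      omega
  · have := ceil_logb_sqrt_minDim_le f
    have := ceil_logb_sqrt_minDim_le f.transpose
    omega
  · set K := min (minDim f) (minDim f.transpose)
    have hnonneg : 0 ≤ ⌈Real.logb 2 (√((K : ℝ) + 2))⌉ := by
      refine Int.ceil_nonneg (Real.logb_nonneg (by norm_num) (Real.one_le_sqrt.mpr ?_))
      have : (0 : ℝ) ≤ K := Nat.cast_nonneg K
      linarith
    -- The nonnegative ceiling itself serves as the number of qubits per party.
    obtain ⟨n, hn⟩ := Int.eq_ofNat_of_zero_le hnonneg
    have hle : (K : ℝ) + 2 ≤ 4 ^ n := by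
      rw [← logb_two_sqrt_le_iff (by positivity)]
      have := Int.le_ceil (Real.logb 2 (√((K : ℝ) + 2)))
      rw [hn] at this
      exact_mod_cast this
    have := smpQCC_le f (n := n) (by exact_mod_cast hle)
    rw [hn]
    exact_mod_cast this
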